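/- A complex equiangular $(n,m)$-frame is a family of $n$ unit vectors $\varphi_1,\dots,\varphi_n\in\mathbb{C}^m$ that is a tight frame (for some $A>0$, $\sum_{i}|\langle\varphi_i,x\rangle|^2=A\|x\|^2$ for all $x\in\mathbb{C}^m$) and satisfies $|\langle\varphi_i,\varphi_j\rangle|=\sqrt{\frac{n-m}{m(n-1)}}$ for all $i\neq j$. Two such frames, with Gram matrices $G=(\langle\varphi_i,\varphi_j\rangle)_{i,j}$ and $G'$, are called equivalent if $G'=PDGD^*P^T$ for some permutation matrix $P$ and some unitary diagonal matrix $D$. **Proposition.** There exists a unique complex equiangular $(7,3)$-frame, up to equivalence. That is, a complex equiangular $(7,3)$-frame exists, and any two complex equiangular $(7,3)$-frames are equivalent. -/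

import Mathlib

/-- The Welch bound `α_{n,m} = √((n - m) / (m (n - 1)))` for `n` unit vectors in `ℂ^m`. -/
noncomputable def welchBound (n m : ℕ) : ℝ :=
  Real.sqrt (((n : ℝ) - m) / (m * ((n : ℝ) - 1)))

/-- A complex equiangular `(n,m)`-frame: `n` unit vectors in `ℂ^m` which form a tight frame and
whose mutual inner products all have absolute value equal to the Welch bound. -/
structure IsEquiangularFrame {n m : ℕ} (φ : Fin n → EuclideanSpace ℂ (Fin m)) : Prop where
  norm_eq_one : ∀ i, ‖φ i‖ = 1
  tight : ∃ A : ℝ, 0 < A ∧ ∀ x : EuclideanSpace ℂ (Fin m), ∑ i, ‖inner ℂ (φ i) x‖ ^ 2 = A * ‖x‖ ^ 2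
  norm_inner_eq : ∀ i j, i ≠ j → ‖inner ℂ (φ i) (φ j)‖ = welchBound n m

/-- Two matrices are equivalent if `G' = P D G D* Pᵀ` for a permutation matrix `P` and a unitary
diagonal matrix `D`. -/
def GramEquivalent {n : ℕ} (G G' : Matrix (Fin n) (Fin n) ℂ) : Prop :=
  ∃ (σ : Equiv.Perm (Fin n)) (d : Fin n → ℂ), (∀ i, ‖d i‖ = 1) ∧
    G' = σ.permMatrix ℂ * Matrix.diagonal d * G * (Matrix.diagonal d).conjTranspose *
      (σ.permMatrix ℂ).transpose

/-- Two frames are equivalent if their Gram matrices `(⟨φ i, φ j⟩)` are. -/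
def FrameEquivalent {n m : ℕ} (φ ψ : Fin n → EuclideanSpace ℂ (Fin m)) : Prop :=
  GramEquivalent (Matrix.gram ℂ φ) (Matrix.gram ℂ ψ)

/-! The seven projections onto the frame lines span at most 7 of the 9 dimensions of 3 × 3 matrices,
so some Z ≠ 0 with tr Z² = 0 satisfies ⟨f, Zf⟩ = 0 for every frame vector f; tightness adds tr Z =
0. The projections together with Z and Zᴴ form a basis with an explicit dual, and a partial trace of
the resulting resolution of the identity makes ZᴴZ + ZZᴴ scalar (`anticommutator_of_annihilator`).
This forces Z to be a multiple of a unitary with eigenvalues μ, μζ, μζ², where ζ is a primitive cube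
root of unity. In its eigenbasis, ⟨f, Zf⟩ = 0 says that the coordinates of f have equal modulus
(`exists_flat_coordinates`).

For flat vectors let a, b, c be the cyclic ratios of coordinates, so abc = 1. Equiangularity says
that 1, a, ā, b, b̄, c, c̄ are the columns of a complex Hadamard matrix. Expanding ab̄ in these
columns gives a² ∝ b or b² ∝ a (`sq_eq_smul_of_hexagon`). Up to phases, Gram entries are then (1 + q
+ q³)/3 with q a ratio of two values of a, and equiangularity reads 1 + q + … + q⁶ = 0. So every
frame is equivalent to the harmonic frame of {0, 1, 3} in ℤ/7, which exists because {0, 1, 3} is a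
perfect difference set. -/

/-! ### 3 × 3 matrices with tr Z = tr Z² = 0 -/

open Matrix in
theorem matrix_fin_three_cayley_hamilton (Z : Matrix (Fin 3) (Fin 3) ℂ) (h1 : Z.trace = 0)
    (h2 : (Z * Z).trace = 0) : Z * Z * Z = Z.det • (1 : Matrix (Fin 3) (Fin 3) ℂ) := by
  simp only [trace_fin_three, Matrix.mul_apply, Fin.sum_univ_three] at h1 h2
  have h3 : Z 2 2 = - Z 0 0 - Z 1 1 := by linear_combination h1
  rw [h3] at h2
  ext i j
  fin_cases i <;> fin_cases j <;>
    simp [Matrix.mul_apply, Fin.sum_univ_three, det_fin_three, h3]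
  · linear_combination (1/2 * Z 0 0) * h2
  · linear_combination (1/2 * Z 0 1) * h2
  · linear_combination (1/2 * Z 0 2) * h2
  · linear_combination (1/2 * Z 1 0) * h2
  · linear_combination (1/2 * Z 1 1) * h2
  · linear_combination (1/2 * Z 1 2) * h2
  · linear_combination (1/2 * Z 2 0) * h2
  · linear_combination (1/2 * Z 2 1) * h2
  · linear_combination (1/2 * (- Z 0 0 - Z 1 1)) * h2

-- The first two elementary symmetric functions of the eigenvalues vanish, so only the cubic and
-- constant terms survive.
open Matrix in
theorem det_sub_smul_one_fin_three (Z : Matrix (Fin 3) (Fin 3) ℂ) (h1 : Z.trace = 0)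
    (h2 : (Z * Z).trace = 0) (μ : ℂ) : (Z - μ • (1 : Matrix (Fin 3) (Fin 3) ℂ)).det =
      Z.det - μ ^ 3 := by
  simp only [trace_fin_three, Matrix.mul_apply, Fin.sum_univ_three] at h1 h2
  have h3 : Z 2 2 = - Z 0 0 - Z 1 1 := by linear_combination h1
  rw [h3] at h2
  simp [det_fin_three, h3]
  linear_combination (1/2 * μ) * h2

-- In odd size, anticommutation gives det H · det K = 0, while both squares are invertible.
open Matrix in
theorem anticommuting_fin_three_false {H K : Matrix (Fin 3) (Fin 3) ℂ} {c : ℂ} (hc : c ≠ 0)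
    (hH : H * H = c • (1 : Matrix (Fin 3) (Fin 3) ℂ))
    (hK : K * K = (-c) • (1 : Matrix (Fin 3) (Fin 3) ℂ)) (h : H * K = -(K * H)) : False := by
  have h1 := congrArg det h
  have h2 := congrArg det hH
  have h3 := congrArg det hK
  simp only [det_neg, det_mul, det_smul, det_one, Fintype.card_fin] at h1 h2 h3
  have hH0 : H.det ≠ 0 := fun h0 => hc (pow_eq_zero_iff (n := 3) (by norm_num) |>.1
    (by simpa [h0] using h2.symm))
  have hK0 : K.det ≠ 0 := fun h0 => hc (neg_eq_zero.1 (pow_eq_zero_iff (n := 3) (by norm_num) |>.1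
    (by simpa [h0] using h3.symm)))
  have : H.det * K.det = 0 := by linear_combination h1 / 2
  simp [hH0, hK0] at this

-- Normality turns (YᴴY)² into (Yᴴ)²Y² = 0; then AᴴA = 0 ⇒ A = 0 applies twice.
open Matrix ComplexOrder in
theorem eq_zero_of_normal_of_mul_self_eq_zero {Y : Matrix (Fin 3) (Fin 3) ℂ}
    (h : Yᴴ * Y = Y * Yᴴ) (hY : Y * Y = 0) : Y = 0 := by
  have h1 : (Yᴴ * Y)ᴴ * (Yᴴ * Y) = 0 := by
    rw [conjTranspose_mul, conjTranspose_conjTranspose]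
    calc Yᴴ * Y * (Yᴴ * Y) = Yᴴ * (Y * Yᴴ) * Y := by noncomm_ring
      _ = Yᴴ * (Yᴴ * Y) * Y := by rw [h]
      _ = Yᴴ * Yᴴ * (Y * Y) := by noncomm_ring
      _ = 0 := by rw [hY, mul_zero]
  exact conjTranspose_mul_self_eq_zero.1 (conjTranspose_mul_self_eq_zero.1 h1)

-- Multiplying the scalar anticommutator by Z on either side shows that Z² commutes with Zᴴ. Since
-- Z⁴ = det Z · Z, so does Z, once det Z ≠ 0.
open Matrix in
theorem normal_of_anticommutator_eq_smul_one {Z : Matrix (Fin 3) (Fin 3) ℂ} {c : ℂ} (hc : c ≠ 0)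
    (h1 : Z.trace = 0) (h2 : (Z * Z).trace = 0)
    (h : Zᴴ * Z + Z * Zᴴ = c • (1 : Matrix (Fin 3) (Fin 3) ℂ)) :
    Z.det ≠ 0 ∧ Zᴴ * Z = Z * Zᴴ := by
  have hcube := matrix_fin_three_cayley_hamilton Z h1 h2
  have hcomm : Z * Z * Zᴴ = Zᴴ * (Z * Z) := by
    have e1 : Z * (Zᴴ * Z + Z * Zᴴ) = c • Z := by rw [h]; simp
    have e2 : (Zᴴ * Z + Z * Zᴴ) * Z = c • Z := by rw [h]; simp
    have e3 := e1.trans e2.symm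
    have : Z * Zᴴ * Z + Z * Z * Zᴴ = Zᴴ * (Z * Z) + Z * Zᴴ * Z := by
      simpa only [mul_add, add_mul, mul_assoc] using e3
    rw [add_comm] at this
    exact add_right_cancel this
  have hdet : Z.det ≠ 0 := by
    intro h0
    rw [h0, zero_smul] at hcube
    -- Z² is normal, because it commutes with Zᴴ, and its square is zero.
    have hsq : Z * Z = 0 := by
      apply eq_zero_of_normal_of_mul_self_eq_zero
      · rw [conjTranspose_mul]
        calc Zᴴ * Zᴴ * (Z * Z) = Zᴴ * (Zᴴ * (Z * Z)) := by noncomm_ring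
          _ = Zᴴ * (Z * Z) * Zᴴ := by rw [mul_assoc Zᴴ (Z * Z) Zᴴ, hcomm]
          _ = Z * Z * (Zᴴ * Zᴴ) := by rw [← hcomm]; simp only [mul_assoc]
      · rw [← mul_assoc, hcube, zero_mul]
    have hsq' : Zᴴ * Zᴴ = 0 := by rw [← conjTranspose_mul, hsq, conjTranspose_zero]
    refine anticommuting_fin_three_false (H := Z + Zᴴ) (K := Z - Zᴴ) hc ?_ ?_ ?_
    · rw [← h]
      simp only [mul_add, add_mul, hsq, hsq']
      abel
    · rw [neg_smul, ← h]
      simp only [mul_sub, sub_mul, hsq, hsq']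
      abel
    · simp only [mul_sub, sub_mul, mul_add, add_mul, hsq, hsq']
      abel
  refine ⟨hdet, ?_⟩
  have e : Z.det • (Zᴴ * Z) = Z.det • (Z * Zᴴ) := by
    calc Z.det • (Zᴴ * Z) = (Zᴴ * (Z.det • (1 : Matrix (Fin 3) (Fin 3) ℂ))) * Z := by simp
      _ = Zᴴ * (Z * Z) * (Z * Z) := by rw [← hcube]; noncomm_ring
      _ = Z * Z * (Zᴴ * (Z * Z)) := by rw [← mul_assoc (Z * Z) Zᴴ (Z * Z), hcomm]
      _ = Z * Z * Z * (Z * Zᴴ) := by rw [← hcomm]; simp only [mul_assoc]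
      _ = Z.det • (Z * Zᴴ) := by rw [hcube]; simp
  exact smul_right_injective _ hdet e

-- The eigenvalues are the three distinct cube roots of det Z. Eigenvectors are orthogonal because Z
-- is a multiple of an isometry.
open Matrix ComplexOrder in
theorem exists_unitary_diagonalization {Z : Matrix (Fin 3) (Fin 3) ℂ} {s : ℂ}
    (h1 : Z.trace = 0) (h2 : (Z * Z).trace = 0) (hdet : Z.det ≠ 0)
    (hZ : Zᴴ * Z = s • (1 : Matrix (Fin 3) (Fin 3) ℂ)) :
    ∃ (V : Matrix (Fin 3) (Fin 3) ℂ) (μ ζ : ℂ), μ ≠ 0 ∧ IsPrimitiveRoot ζ 3 ∧ Vᴴ * V = 1 ∧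
      Z = Vᴴ * diagonal (fun j : Fin 3 => μ * ζ ^ (j : ℕ)) * V := by
  obtain ⟨μ, hμ⟩ := IsAlgClosed.exists_pow_nat_eq Z.det (n := 3) (by norm_num)
  have hμ0 : μ ≠ 0 := by
    rintro rfl
    exact hdet (by rw [← hμ]; norm_num)
  obtain ⟨ζ, hζ⟩ : ∃ ζ : ℂ, IsPrimitiveRoot ζ 3 :=
    ⟨_, Complex.isPrimitiveRoot_exp 3 (by norm_num)⟩
  have hev : ∀ j : Fin 3, ∃ v : Fin 3 → ℂ, v ≠ 0 ∧ Z *ᵥ v = (μ * ζ ^ (j : ℕ)) • v := by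
    intro j
    have hd : (Z - (μ * ζ ^ (j : ℕ)) • (1 : Matrix (Fin 3) (Fin 3) ℂ)).det = 0 := by
      rw [det_sub_smul_one_fin_three Z h1 h2, ← hμ, mul_pow, ← pow_mul, mul_comm (j : ℕ), pow_mul,
        hζ.pow_eq_one]
      simp
    obtain ⟨v, hv0, hv⟩ := exists_mulVec_eq_zero_iff.2 hd
    refine ⟨v, hv0, ?_⟩
    rw [sub_mulVec, smul_mulVec, one_mulVec, sub_eq_zero] at hv
    exact hv
  choose v hv0 hv using hev
  have hip : ∀ j k, s * (star (v j) ⬝ᵥ v k) =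
      star (μ * ζ ^ (j : ℕ)) * (μ * ζ ^ (k : ℕ)) * (star (v j) ⬝ᵥ v k) := by
    intro j k
    have e : star (Z *ᵥ v j) ⬝ᵥ (Z *ᵥ v k) = s * (star (v j) ⬝ᵥ v k) := by
      rw [star_mulVec, dotProduct_mulVec, vecMul_vecMul, hZ, vecMul_smul, vecMul_one,
        smul_dotProduct, smul_eq_mul]
    rw [← e, hv, hv, star_smul, smul_dotProduct, dotProduct_smul, smul_eq_mul, smul_eq_mul]
    ring
  have hne : ∀ j, star (v j) ⬝ᵥ v j ≠ 0 := fun j h => hv0 j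
    (dotProduct_star_self_eq_zero.1 h)
  have horth : ∀ j k, j ≠ k → star (v j) ⬝ᵥ v k = 0 := by
    intro j k hjk
    by_contra hne'
    have e1 := mul_right_cancel₀ (hne j) (hip j j)
    have e2 := mul_right_cancel₀ hne' (hip j k)
    rw [e1] at e2
    have hζ0 : ζ ≠ 0 := hζ.ne_zero (by norm_num)
    have hs : star (μ * ζ ^ (j : ℕ)) ≠ 0 := star_ne_zero.2 (mul_ne_zero hμ0 (pow_ne_zero _ hζ0))
    have e3 := mul_left_cancel₀ hμ0 (mul_left_cancel₀ hs e2)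
    exact hjk (Fin.ext (hζ.pow_inj j.2 k.2 e3))
  have hpos : ∀ j, ∃ r : ℂ, r ≠ 0 ∧ star r * r = star (v j) ⬝ᵥ v j := by
    intro j
    have e : star (v j) ⬝ᵥ v j = ((∑ a, ‖v j a‖ ^ 2 : ℝ) : ℂ) := by
      simp [dotProduct, Complex.conj_mul']
    refine ⟨((Real.sqrt (∑ a, ‖v j a‖ ^ 2) : ℝ) : ℂ), ?_, ?_⟩
    · intro h0
      apply hne j
      rw [e, ← Real.sq_sqrt (Finset.sum_nonneg fun a _ => sq_nonneg ‖v j a‖)]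
      push_cast
      rw [h0]; simp
    · rw [e, Complex.star_def, Complex.conj_ofReal, ← Complex.ofReal_mul,
        Real.mul_self_sqrt (Finset.sum_nonneg fun a _ => sq_nonneg ‖v j a‖)]
  choose r hr0 hr using hpos
  let V : Matrix (Fin 3) (Fin 3) ℂ := of fun j a => star (v j a) / star (r j)
  have hVV : V * Vᴴ = 1 := by
    ext j k
    have e : (V * Vᴴ) j k = (star (v j) ⬝ᵥ v k) / (star (r j) * r k) := by
      simp only [V, Matrix.mul_apply, conjTranspose_apply, of_apply, dotProduct, Pi.star_apply,
        star_div₀, star_star, Finset.sum_div]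
      exact Finset.sum_congr rfl fun a _ => by rw [div_mul_div_comm]
    rw [e]
    by_cases hjk : j = k
    · subst hjk
      rw [one_apply_eq, hr, div_self (hne j)]
    · rw [one_apply_ne hjk, horth j k hjk, zero_div]
  have hVV' : Vᴴ * V = 1 := mul_eq_one_comm.1 hVV
  have hZV : Z * Vᴴ = Vᴴ * diagonal (fun j : Fin 3 => μ * ζ ^ (j : ℕ)) := by
    ext a j
    rw [mul_diagonal]
    have e := congrFun (hv j) a
    simp only [mulVec, dotProduct, Pi.smul_apply, smul_eq_mul] at e
    simp only [V, Matrix.mul_apply, conjTranspose_apply, of_apply, star_div₀, star_star,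
      ← mul_div_assoc, ← Finset.sum_div]
    rw [e]; ring
  exact ⟨V, μ, ζ, hμ0, hζ, hVV', by rw [← hZV, mul_assoc, hVV', mul_one]⟩

/-! ### A matrix annihilated by all frame projections -/

open Matrix in
/-- The kernel of `W ↦ (⟨f i, W f i⟩)ᵢ` on `3 × 3` matrices has dimension at least two, so it
contains a nonzero matrix with `tr Z² = 0`. -/
theorem exists_isotropic_annihilator (F : Matrix (Fin 3) (Fin 7) ℂ) :
    ∃ Z : Matrix (Fin 3) (Fin 3) ℂ, Z ≠ 0 ∧ (Z * Z).trace = 0 ∧ ∀ i, (Fᴴ * Z * F) i i = 0 := by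
  let L : Matrix (Fin 3) (Fin 3) ℂ →ₗ[ℂ] (Fin 7 → ℂ) :=
    { toFun := fun W i => (Fᴴ * W * F) i i
      map_add' := fun X Y => by ext i; simp [Matrix.mul_add, Matrix.add_mul]
      map_smul' := fun t X => by ext i; simp }
  have hker : 1 < Module.finrank ℂ (LinearMap.ker L) := by
    have e := LinearMap.finrank_range_add_finrank_ker L
    have e2 : Module.finrank ℂ (Matrix (Fin 3) (Fin 3) ℂ) = 9 := by simp [Module.finrank_matrix]
    have e3 : Module.finrank ℂ (LinearMap.range L) ≤ 7 := by
      simpa using Submodule.finrank_le (LinearMap.range L)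
    omega
  have : Nontrivial (LinearMap.ker L) := Module.nontrivial_of_finrank_pos (R := ℂ) (by omega)
  obtain ⟨Y, hY⟩ := exists_ne (0 : LinearMap.ker L)
  obtain ⟨X, hX⟩ := exists_linearIndependent_pair_of_one_lt_finrank hker hY
  rw [LinearIndependent.pair_iff] at hX
  have hL : ∀ W : LinearMap.ker L, ∀ i, (Fᴴ * (W : Matrix (Fin 3) (Fin 3) ℂ) * F) i i = 0 :=
    fun W i => congrFun (LinearMap.mem_ker.1 W.2) i
  by_cases hq : ((Y : Matrix (Fin 3) (Fin 3) ℂ) * Y).trace = 0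
  · exact ⟨Y, fun h => hY (Subtype.ext h), hq, hL Y⟩
  -- On the line tY + X, tr Z² is a genuine quadratic in t, so it has a complex root.
  obtain ⟨t, ht⟩ := exists_quadratic_eq_zero
    (b := 2 * ((Y : Matrix (Fin 3) (Fin 3) ℂ) * X).trace)
    (c := ((X : Matrix (Fin 3) (Fin 3) ℂ) * X).trace) hq
    ((IsAlgClosed.exists_pow_nat_eq (discrim ((Y : Matrix (Fin 3) (Fin 3) ℂ) * Y).trace
      (2 * ((Y : Matrix (Fin 3) (Fin 3) ℂ) * X).trace) ((X : Matrix (Fin 3) (Fin 3) ℂ) * X).trace)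
      (n := 2) (by norm_num)).imp fun s hs =>
      hs.symm.trans (sq s))
  refine ⟨(t • Y + X : LinearMap.ker L), ?_, ?_, hL _⟩
  · intro h
    have := hX t 1 (by rw [one_smul]; exact Subtype.ext h)
    simp at this
  · have e : ((X : Matrix (Fin 3) (Fin 3) ℂ) * Y).trace =
      ((Y : Matrix (Fin 3) (Fin 3) ℂ) * X).trace := trace_mul_comm _ _
    simp [mul_add, add_mul, e]
    linear_combination ht

open Matrix ComplexOrder in
theorem anticommutator_of_annihilator {F : Matrix (Fin 3) (Fin 7) ℂ}
    (h1 : ∀ i, (Fᴴ * F) i i = 1)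
    (h2 : ∀ i j, i ≠ j → (Fᴴ * F) i j * (Fᴴ * F) j i = 2 / 9)
    (h3 : F * Fᴴ = (7 / 3 : ℂ) • (1 : Matrix (Fin 3) (Fin 3) ℂ))
    {Z : Matrix (Fin 3) (Fin 3) ℂ} (hZ0 : Z ≠ 0) (hZ : ∀ i, (Fᴴ * Z * F) i i = 0)
    (htr : Z.trace = 0) (hsq : (Z * Z).trace = 0) :
    ∃ c : ℂ, c ≠ 0 ∧ Zᴴ * Z + Z * Zᴴ = c • (1 : Matrix (Fin 3) (Fin 3) ℂ) := by
  set N : ℂ := (Zᴴ * Z).trace with hN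
  have hN0 : N ≠ 0 := fun h => hZ0 (trace_conjTranspose_mul_self_eq_zero_iff.1 h)
  let B : Matrix (Fin 7 ⊕ Fin 2) (Fin 3 × Fin 3) ℂ := of fun r p =>
    Sum.elim (fun i => F p.1 i * star (F p.2 i)) ![Z p.1 p.2, star (Z p.2 p.1)] r
  -- The dual basis: 9/7 · 2/9 − 2/7 = 0 off the diagonal and 9/7 − 2/7 = 1 on it.
  let C : Matrix (Fin 3 × Fin 3) (Fin 7 ⊕ Fin 2) ℂ := of fun p r =>
    Sum.elim (fun i => 9 / 7 * (star (F p.1 i) * F p.2 i) - 2 / 7 * (1 : Matrix _ _ ℂ) p.1 p.2)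
      ![star (Z p.1 p.2) / N, Z p.2 p.1 / N] r
  have e1 := h1
  have e2 := h2
  have eZ := hZ
  have eZ' : ∀ i, star ((Fᴴ * Z * F) i i) = 0 := fun i => by rw [hZ, star_zero]
  have etr' : star Z.trace = 0 := by rw [htr, star_zero]
  have esq' : star (Z * Z).trace = 0 := by rw [hsq, star_zero]
  simp only [Matrix.mul_apply, conjTranspose_apply, Fin.sum_univ_three, trace_fin_three, star_add,
    star_mul', Complex.star_def, Complex.conj_conj] at e1 e2 eZ eZ' htr hsq etr' esq' hN
  have hBC : B * C = 1 := by
    ext r q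
    rcases r with i | i
    · rcases q with j | j
      · by_cases hij : i = j
        · subst hij
          simp [B, C, Matrix.mul_apply, Fintype.sum_prod_type, Fin.sum_univ_three]
          linear_combination (9 / 7 * ((starRingEnd ℂ) (F 0 i) * F 0 i +
            (starRingEnd ℂ) (F 1 i) * F 1 i + (starRingEnd ℂ) (F 2 i) * F 2 i) + 1) * e1 i
        · simp [B, C, Matrix.mul_apply, Fintype.sum_prod_type, Fin.sum_univ_three, hij]
          linear_combination 9 / 7 * e2 i j hij - 2 / 7 * e1 i
      · fin_cases j <;> simp [B, C, Matrix.mul_apply, Fintype.sum_prod_type, Fin.sum_univ_three]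
        · linear_combination 1 / N * eZ' i
        · linear_combination 1 / N * eZ i
    · rcases q with j | j
      · fin_cases i <;> simp [B, C, Matrix.mul_apply, Fintype.sum_prod_type, Fin.sum_univ_three]
        · linear_combination 9 / 7 * eZ j - 2 / 7 * htr
        · linear_combination 9 / 7 * eZ' j - 2 / 7 * etr'
      · fin_cases i <;> fin_cases j <;>
          simp [B, C, Matrix.mul_apply, Fintype.sum_prod_type, Fin.sum_univ_three]
        · field_simp
          linear_combination -hN
        · linear_combination 1 / N * hsq
        · linear_combination 1 / N * esq'
        · field_simp
          linear_combination -hN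
  have hCB : C * B = 1 := (mul_eq_one_comm_of_card_eq _ _ _ (by simp)).1 hBC
  refine ⟨2 / 3 * N, mul_ne_zero (by norm_num) hN0, ?_⟩
  ext b d
  have e : ∀ a, (C * B) (a, b) (a, d) = (1 : Matrix (Fin 3) (Fin 3) ℂ) b d := fun a => by
    rw [hCB]; simp [Matrix.one_apply]
  -- Partial trace: the frame terms sum to F Fᴴ = 7/3, leaving 3 − 7/3 = 2/3 for the terms in Z.
  have hs : ∑ a, (C * B) (a, b) (a, d) = 3 * (1 : Matrix (Fin 3) (Fin 3) ℂ) b d := by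
    simp [e]
  have h3' := congrFun (congrFun h3 b) d
  have hdiv : (Zᴴ * Z + Z * Zᴴ) b d / N = 2 / 3 * (1 : Matrix (Fin 3) (Fin 3) ℂ) b d := by
    simp only [Matrix.mul_apply, conjTranspose_apply, Fin.sum_univ_seven, Matrix.smul_apply,
      smul_eq_mul, Complex.star_def] at h3'
    simp only [B, C, Matrix.mul_apply, of_apply, Fintype.sum_sum_type, Sum.elim_inl, Sum.elim_inr,
      Fin.sum_univ_three, Fin.sum_univ_two, Fin.sum_univ_seven, Complex.star_def,
      cons_val_zero, cons_val_one] at hs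
    simp only [Matrix.add_apply, Matrix.mul_apply, conjTranspose_apply, Fin.sum_univ_three,
      Complex.star_def]
    have hδ' : ∀ (b : Fin 3) (v : Fin 3 → ℂ), (1 : Matrix (Fin 3) (Fin 3) ℂ) 0 b * v 0 +
        (1 : Matrix (Fin 3) (Fin 3) ℂ) 1 b * v 1 + (1 : Matrix (Fin 3) (Fin 3) ℂ) 2 b * v 2 =
        v b := by
      intro b v
      simpa [Matrix.vecMul, dotProduct, Fin.sum_univ_three, mul_comm] using
        congrFun (vecMul_one v) b
    have hδ := fun l => hδ' b fun a => F a l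
    linear_combination hs - h3' + 2 / 7 * ((starRingEnd ℂ) (F d 0) * hδ 0 + (starRingEnd ℂ) (F d 1) * hδ 1 +
      (starRingEnd ℂ) (F d 2) * hδ 2 + (starRingEnd ℂ) (F d 3) * hδ 3 +
      (starRingEnd ℂ) (F d 4) * hδ 4 + (starRingEnd ℂ) (F d 5) * hδ 5 +
      (starRingEnd ℂ) (F d 6) * hδ 6)
      - 9 / 7 * (F b 0 * (starRingEnd ℂ) (F d 0) * e1 0 + F b 1 * (starRingEnd ℂ) (F d 1) * e1 1 +
      F b 2 * (starRingEnd ℂ) (F d 2) * e1 2 + F b 3 * (starRingEnd ℂ) (F d 3) * e1 3 +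
      F b 4 * (starRingEnd ℂ) (F d 4) * e1 4 + F b 5 * (starRingEnd ℂ) (F d 5) * e1 5 +
      F b 6 * (starRingEnd ℂ) (F d 6) * e1 6)
  rw [div_eq_iff hN0] at hdiv
  rw [hdiv, Matrix.smul_apply, smul_eq_mul]
  ring

/-! ### The Hadamard matrix of coordinate ratios -/

open Matrix ComplexConjugate in
theorem hexagon_orthogonality {a b c : Fin 7 → ℂ}
    (ha : ∀ k, conj (a k) * a k = 1) (hb : ∀ k, conj (b k) * b k = 1)
    (hc : ∀ k, conj (c k) * c k = 1)
    (h : ∀ k l, k ≠ l → 1 + (conj (a k) * a l + a k * conj (a l)) +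
      (conj (b k) * b l + b k * conj (b l)) + (conj (c k) * c l + c k * conj (c l)) = 0)
    (M : Matrix (Fin 7) (Fin 7) ℂ)
    (hM : M = of fun k => ![1, a k, conj (a k), b k, conj (b k), c k, conj (c k)]) :
    M * Mᴴ = (7 : ℂ) • (1 : Matrix (Fin 7) (Fin 7) ℂ) ∧
      Mᴴ * M = (7 : ℂ) • (1 : Matrix (Fin 7) (Fin 7) ℂ) := by
  have h1 : M * Mᴴ = (7 : ℂ) • (1 : Matrix (Fin 7) (Fin 7) ℂ) := by
    ext k l
    have e : (M * Mᴴ) k l = 1 + (conj (a k) * a l + a k * conj (a l)) +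
      (conj (b k) * b l + b k * conj (b l)) + (conj (c k) * c l + c k * conj (c l)) := by
      subst hM
      simp only [Matrix.mul_apply, conjTranspose_apply, of_apply, Fin.sum_univ_seven]
      simp
      ring
    rw [e]
    by_cases hkl : k = l
    · subst hkl
      simp
      linear_combination 2 * ha k + 2 * hb k + 2 * hc k
    · rw [h k l hkl]
      simp [hkl]
  refine ⟨h1, ?_⟩
  have h2 : ((1 / 7 : ℂ) • M) * Mᴴ = 1 := by
    rw [smul_mul_assoc, h1, smul_smul]
    norm_num
  have h3 := mul_eq_one_comm.1 h2
  rw [mul_smul_comm] at h3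
  rw [← h3, smul_smul]
  norm_num

-- By abc = 1, the product ab̄ is orthogonal to every column except ā and b, so ab̄ = βā + κb.
-- Comparing moduli then kills β or κ.
open Matrix ComplexConjugate in
theorem sq_eq_smul_of_hexagon {a b c : Fin 7 → ℂ}
    (ha : ∀ k, conj (a k) * a k = 1) (hb : ∀ k, conj (b k) * b k = 1)
    (habc : ∀ k, a k * b k * c k = 1)
    (h : ∀ k l, k ≠ l → 1 + (conj (a k) * a l + a k * conj (a l)) +
      (conj (b k) * b l + b k * conj (b l)) + (conj (c k) * c l + c k * conj (c l)) = 0) :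
    ∃ β : ℂ, (∀ k, a k ^ 2 = β * b k) ∨ ∀ k, b k ^ 2 = β * a k := by
  have hc' : ∀ k, c k = conj (a k) * conj (b k) := fun k => by
    linear_combination (conj (a k) * conj (b k)) * habc k - (conj (b k) * b k * c k) * ha k
      - c k * hb k
  have hcc : ∀ k, conj (c k) = a k * b k := fun k => by simp [hc']
  have hc : ∀ k, conj (c k) * c k = 1 := fun k => by rw [hcc, habc]
  obtain ⟨M, hM⟩ : ∃ M : Matrix (Fin 7) (Fin 7) ℂ,
    M = of fun k => ![1, a k, conj (a k), b k, conj (b k), c k, conj (c k)] := ⟨_, rfl⟩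
  obtain ⟨h1, h2⟩ := hexagon_orthogonality ha hb hc h M hM
  have hs : ∀ i j, i ≠ j → ∑ k, conj (M k i) * M k j = 0 := by
    intro i j hij
    have e := congrFun (congrFun h2 i) j
    simpa [Matrix.mul_apply, hij] using e
  obtain ⟨β, hβ⟩ : ∃ β, β = (1 / 7) * ∑ l, a l * (a l * conj (b l)) := ⟨_, rfl⟩
  obtain ⟨κ, hκ⟩ : ∃ κ, κ = (1 / 7) * ∑ l, conj (b l) * (a l * conj (b l)) := ⟨_, rfl⟩
  have hexp : ∀ k, a k * conj (b k) = β * conj (a k) + κ * b k := by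
    intro k
    have e := congrFun (congrArg (fun A => A *ᵥ fun l => a l * conj (b l)) h1) k
    simp only [← mulVec_mulVec, smul_mulVec, one_mulVec, Pi.smul_apply, smul_eq_mul] at e
    have hmv : ∀ i, (Mᴴ *ᵥ fun l => a l * conj (b l)) i =
        ∑ l, conj (M l i) * (a l * conj (b l)) := fun i => rfl
    have c0 : (Mᴴ *ᵥ fun l => a l * conj (b l)) 0 = 0 := by
      rw [hmv, ← hs 3 1 (by decide)]
      refine Finset.sum_congr rfl fun l _ => ?_
      simp [hM]; ring
    have c1 : (Mᴴ *ᵥ fun l => a l * conj (b l)) 1 = 0 := by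
      rw [hmv, ← hs 3 0 (by decide)]
      refine Finset.sum_congr rfl fun l _ => ?_
      simp [hM]
      linear_combination conj (b l) * ha l
    have c2 : (Mᴴ *ᵥ fun l => a l * conj (b l)) 2 = 7 * β := by
      rw [hmv, hβ, ← mul_assoc]; norm_num
      refine Finset.sum_congr rfl fun l _ => ?_
      simp [hM]
    have c3 : (Mᴴ *ᵥ fun l => a l * conj (b l)) 3 = 7 * κ := by
      rw [hmv, hκ, ← mul_assoc]; norm_num
      refine Finset.sum_congr rfl fun l _ => ?_
      simp [hM]
    have c4 : (Mᴴ *ᵥ fun l => a l * conj (b l)) 4 = 0 := by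
      rw [hmv, ← hs 0 1 (by decide)]
      refine Finset.sum_congr rfl fun l _ => ?_
      simp [hM]
      linear_combination a l * hb l
    have c5 : (Mᴴ *ᵥ fun l => a l * conj (b l)) 5 = 0 := by
      rw [hmv, ← hs 2 1 (by decide)]
      refine Finset.sum_congr rfl fun l _ => ?_
      simp [hM, hcc]
      linear_combination a l ^ 2 * hb l
    have c6 : (Mᴴ *ᵥ fun l => a l * conj (b l)) 6 = 0 := by
      rw [hmv, ← hs 3 4 (by decide)]
      refine Finset.sum_congr rfl fun l _ => ?_
      simp [hM, hc']
      linear_combination conj (b l) ^ 2 * ha l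
    rw [Matrix.mulVec, dotProduct, Fin.sum_univ_seven, c0, c1, c2, c3, c4, c5, c6] at e
    simp [hM] at e
    linear_combination -e / 7
  have hsum1 : ∑ k, c k = 0 := by simpa [hM] using hs 0 5 (by decide)
  have hsum2 : ∑ k, c k * c k = 0 := by simpa [hM] using hs 6 5 (by decide)
  have hsum1' : ∑ k, conj (c k) = 0 := by rw [← map_sum, hsum1, map_zero]
  -- This is |βā + κb|² = 1, with the cross terms rewritten by c̄ = ab.
  have hmod : ∀ k, (β * conj κ) * c k + (conj β * κ) * conj (c k) =
      1 - conj β * β - conj κ * κ := by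
    intro k
    have e := congrArg conj (hexp k)
    simp only [map_mul, map_add, Complex.conj_conj] at e
    rw [hcc, hc']
    have e2 : (conj (a k) * b k) * (a k * conj (b k)) = 1 := by
      linear_combination (conj (b k) * b k) * ha k + hb k
    rw [e, hexp k] at e2
    linear_combination e2 - (conj β * β) * ha k - (conj κ * κ) * hb k
  have hconst : 1 - conj β * β - conj κ * κ = 0 := by
    have e : ∑ k : Fin 7, ((β * conj κ) * c k + (conj β * κ) * conj (c k)) =
      ∑ k : Fin 7, (1 - conj β * β - conj κ * κ) := Finset.sum_congr rfl fun k _ => hmod k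
    rw [Finset.sum_add_distrib, ← Finset.mul_sum, ← Finset.mul_sum, hsum1, hsum1'] at e
    simp at e
    linear_combination -e / 7
  -- Multiply by c and sum: Σ c² = 0 leaves only the conjugate cross term.
  have hξ : conj β * κ = 0 := by
    have e : ∑ k : Fin 7, (β * conj κ) * (c k * c k) = ∑ k : Fin 7, -(conj β * κ) :=
      Finset.sum_congr rfl fun k _ => by
        linear_combination c k * hmod k + c k * hconst - (conj β * κ) * hc k
    rw [← Finset.mul_sum, hsum2] at e
    simpa using e
  rcases mul_eq_zero.1 hξ with hβ0 | hκ0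
  · have hβ0' : β = 0 := by simpa using hβ0
    refine ⟨conj κ, Or.inr fun k => ?_⟩
    have e := hexp k
    rw [hβ0'] at e hconst
    linear_combination (-conj κ * b k) * e + (conj κ * a k) * hb k + b k ^ 2 * hconst
  · refine ⟨β, Or.inl fun k => ?_⟩
    have e := hexp k
    rw [hκ0] at e
    linear_combination (a k * b k) * e - (a k ^ 2) * hb k + (β * b k) * ha k

/-! ### Flat coordinates -/

open Matrix ComplexConjugate in
theorem exists_flat_coordinates {F : Matrix (Fin 3) (Fin 7) ℂ}
    (h1 : ∀ i, (Fᴴ * F) i i = 1)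
    (h2 : ∀ i j, i ≠ j → (Fᴴ * F) i j * (Fᴴ * F) j i = 2 / 9)
    (h3 : F * Fᴴ = (7 / 3 : ℂ) • (1 : Matrix (Fin 3) (Fin 3) ℂ)) :
    ∃ X : Matrix (Fin 3) (Fin 7) ℂ, (∀ j k, conj (X j k) * X j k = 1) ∧
      Fᴴ * F = (1 / 3 : ℂ) • (Xᴴ * X) := by
  obtain ⟨Z, hZ0, hsq, hZ⟩ := exists_isotropic_annihilator F
  have htr : Z.trace = 0 := by
    have e : (Fᴴ * Z * F).trace = 0 := Finset.sum_eq_zero fun i _ => hZ i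
    rw [trace_mul_comm, ← Matrix.mul_assoc, h3] at e
    simpa using e
  obtain ⟨c, hc, hac⟩ := anticommutator_of_annihilator h1 h2 h3 hZ0 hZ htr hsq
  obtain ⟨hdet, hnormal⟩ := normal_of_anticommutator_eq_smul_one hc htr hsq hac
  have hunit : Zᴴ * Z = (c / 2) • (1 : Matrix (Fin 3) (Fin 3) ℂ) := by
    rw [← hnormal, ← two_smul ℂ] at hac
    rw [div_eq_inv_mul, ← smul_smul, ← hac, smul_smul]
    norm_num
  obtain ⟨V, μ, ζ, hμ, hζ, hV, hZV⟩ := exists_unitary_diagonalization htr hsq hdet hunit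
  obtain ⟨Y, hY⟩ : ∃ Y, Y = V * F := ⟨_, rfl⟩
  have hYY : Yᴴ * Y = Fᴴ * F := by
    rw [hY, conjTranspose_mul, Matrix.mul_assoc, ← Matrix.mul_assoc Vᴴ, hV, Matrix.one_mul]
  have hζ3 : ζ ^ 3 = 1 := hζ.pow_eq_one
  have hζ1 : ζ ≠ 1 := hζ.ne_one (by norm_num)
  have hζs : 1 + ζ + ζ ^ 2 = 0 := by
    have e : (ζ - 1) * (1 + ζ + ζ ^ 2) = 0 := by linear_combination hζ3
    exact (mul_eq_zero.1 e).resolve_left (sub_ne_zero.2 hζ1)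
  have hζc : conj ζ = ζ ^ 2 := by
    have e : conj ζ * ζ = 1 := by
      rw [Complex.conj_mul', Complex.norm_eq_one_of_pow_eq_one hζ3 (by norm_num)]
      norm_num
    linear_combination ζ ^ 2 * e - conj ζ * hζ3
  have hflat : ∀ j k, conj (Y j k) * Y j k = 1 / 3 := by
    intro j k
    have e1 : conj (Y 0 k) * Y 0 k + conj (Y 1 k) * Y 1 k + conj (Y 2 k) * Y 2 k = 1 := by
      rw [← h1 k, ← hYY]
      simp [Matrix.mul_apply, Fin.sum_univ_three]
    -- ⟨f, Zf⟩ = 0 in the eigenbasis, divided by μ; together with its conjugate it makes the three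
    -- squared moduli equal.
    have e2 : conj (Y 0 k) * Y 0 k + ζ * (conj (Y 1 k) * Y 1 k) +
        ζ ^ 2 * (conj (Y 2 k) * Y 2 k) = 0 := by
      have e : (Yᴴ * diagonal (fun j : Fin 3 => μ * ζ ^ (j : ℕ)) * Y) k k = 0 := by
        rw [← hZ k, hY, conjTranspose_mul]
        conv_rhs => rw [hZV]
        simp only [Matrix.mul_assoc]
      rw [Matrix.mul_apply] at e
      simp only [mul_diagonal, conjTranspose_apply, Fin.sum_univ_three, Complex.star_def] at e
      simp at e
      apply mul_left_cancel₀ hμ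
      linear_combination e
    have e3 := congrArg conj e2
    simp only [map_add, map_mul, map_pow, Complex.conj_conj, hζc, map_zero] at e3
    have e12 : conj (Y 1 k) * Y 1 k = conj (Y 2 k) * Y 2 k := by
      have hne : ζ * (1 - ζ) ≠ 0 :=
        mul_ne_zero (hζ.ne_zero (by norm_num)) (sub_ne_zero.2 hζ1.symm)
      apply mul_left_cancel₀ hne
      linear_combination e2 - e3 + (ζ * (conj (Y 2 k) * Y 2 k)) * hζ3
    have e01 : conj (Y 0 k) * Y 0 k = conj (Y 2 k) * Y 2 k := by
      linear_combination e2 - ζ * e12 - (conj (Y 2 k) * Y 2 k) * hζs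
    have hj : j = 0 ∨ j = 1 ∨ j = 2 := by omega
    rcases hj with rfl | rfl | rfl
    · linear_combination (e1 - e12 + 2 * e01) / 3
    · linear_combination (e1 - e01 + 2 * e12) / 3
    · linear_combination (e1 - e01 - e12) / 3
  have hs3 : ((Real.sqrt 3 : ℝ) : ℂ) * ((Real.sqrt 3 : ℝ) : ℂ) = 3 := by
    rw [← Complex.ofReal_mul, Real.mul_self_sqrt (by norm_num)]
    norm_num
  refine ⟨((Real.sqrt 3 : ℝ) : ℂ) • Y, fun j k => ?_, ?_⟩
  · simp only [Matrix.smul_apply, smul_eq_mul, map_mul, Complex.conj_ofReal]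
    linear_combination (conj (Y j k) * Y j k) * hs3 + 3 * hflat j k
  · rw [conjTranspose_smul, Matrix.smul_mul, Matrix.mul_smul, Complex.star_def,
      Complex.conj_ofReal, smul_smul, smul_smul, mul_assoc, hs3, hYY]
    norm_num

/-! ### Identification with the harmonic frame -/

open ComplexConjugate in
/-- The Gram matrix, up to the factor `3`, of the harmonic frame of the characters `0, 1, 3` of
the cyclic group of order seven. -/
noncomputable def harmonicGram (i j : Fin 7) : ℂ :=
  let q := conj (Complex.exp (2 * Real.pi * Complex.I / 7) ^ (i : ℕ)) *
    Complex.exp (2 * Real.pi * Complex.I / 7) ^ (j : ℕ)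
  1 + q + q ^ 3

open Matrix ComplexConjugate in
theorem gram_eq_harmonicGram_of_sq_eq {X : Fin 3 → Fin 7 → ℂ}
    (hX : ∀ j k, conj (X j k) * X j k = 1)
    (h : ∀ k l, k ≠ l → 1 + (conj (conj (X 0 k) * X 1 k) * (conj (X 0 l) * X 1 l) +
        (conj (X 0 k) * X 1 k) * conj (conj (X 0 l) * X 1 l)) +
      (conj (conj (X 1 k) * X 2 k) * (conj (X 1 l) * X 2 l) +
        (conj (X 1 k) * X 2 k) * conj (conj (X 1 l) * X 2 l)) +
      (conj (conj (X 2 k) * X 0 k) * (conj (X 2 l) * X 0 l) +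
        (conj (X 2 k) * X 0 k) * conj (conj (X 2 l) * X 0 l)) = 0)
    {β : ℂ} (hβ : ∀ k, (conj (X 0 k) * X 1 k) ^ 2 = β * (conj (X 1 k) * X 2 k)) :
    ∃ (σ : Equiv.Perm (Fin 7)) (d : Fin 7 → ℂ), (∀ k, conj (d k) * d k = 1) ∧
      ∀ k l, conj (X 0 k) * X 0 l + conj (X 1 k) * X 1 l + conj (X 2 k) * X 2 l =
        d k * conj (d l) * harmonicGram (σ k) (σ l) := by
  obtain ⟨a, ha⟩ : ∃ a : Fin 7 → ℂ, a = fun k => conj (X 0 k) * X 1 k := ⟨_, rfl⟩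
  obtain ⟨q, hq⟩ : ∃ q : Fin 7 → Fin 7 → ℂ, q = fun k l => conj (a k) * a l := ⟨_, rfl⟩
  have haa : ∀ k, conj (a k) * a k = 1 := fun k => by
    simp only [ha, map_mul, Complex.conj_conj]
    linear_combination (conj (X 1 k) * X 1 k) * hX 0 k + hX 1 k
  have hββ : conj β * β = 1 := by
    have e := congrArg (fun z => conj z * z) (hβ 0)
    simp only [map_mul, map_pow, Complex.conj_conj] at e
    have e0 := haa 0
    simp only [ha, map_mul, Complex.conj_conj] at e0
    linear_combination -e - conj β * β * (X 1 0 * conj (X 1 0)) * hX 2 0 - conj β * β * hX 1 0 +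
      (X 0 0 * conj (X 1 0) * (conj (X 0 0) * X 1 0) + 1) * e0
  have hq1 : ∀ k l, conj (X 1 k) * X 1 l = conj (X 0 k) * X 0 l * q k l := fun k l => by
    simp only [hq, ha, map_mul, Complex.conj_conj]
    linear_combination (-conj (X 1 k) * X 1 l * (conj (X 0 l) * X 0 l)) * hX 0 k
      - conj (X 1 k) * X 1 l * hX 0 l
  have hb : ∀ k, conj (X 1 k) * X 2 k = conj β * a k ^ 2 := fun k => by
    rw [ha]
    simp only
    rw [hβ]
    linear_combination (-conj (X 1 k) * X 2 k) * hββ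
  have hbq : ∀ k l, conj (conj (X 1 k) * X 2 k) * (conj (X 1 l) * X 2 l) = q k l ^ 2 := by
    intro k l
    rw [hb, hb, hq]
    simp only [map_mul, map_pow, Complex.conj_conj]
    linear_combination (conj (a k) ^ 2 * a l ^ 2) * hββ
  have hq2 : ∀ k l, conj (X 2 k) * X 2 l = conj (X 0 k) * X 0 l * q k l ^ 3 := fun k l => by
    have e := hbq k l
    simp only [map_mul, Complex.conj_conj] at e
    linear_combination (conj (X 1 k) * X 1 l) * e + q k l ^ 2 * hq1 k l
      - (conj (X 2 k) * X 2 l * (conj (X 1 l) * X 1 l)) * hX 1 k - (conj (X 2 k) * X 2 l) * hX 1 l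
  have hqq : ∀ k l, conj (q k l) * q k l = 1 := fun k l => by
    simp only [hq, map_mul, Complex.conj_conj]
    linear_combination (conj (a l) * a l) * haa k + haa l
  have hcq : ∀ k l, conj (conj (X 2 k) * X 0 k) * (conj (X 2 l) * X 0 l) = conj (q k l) ^ 3 := by
    intro k l
    have e := congrArg conj (hq2 k l)
    simp only [map_mul, map_pow, Complex.conj_conj] at e ⊢
    linear_combination (conj (X 0 k) * X 0 l) * e +
      (X 0 l * conj (X 0 l) * conj (q k l) ^ 3) * hX 0 k + conj (q k l) ^ 3 * hX 0 l
  -- The ratios of a, b, c between k and l are q, q², q⁻³, so the relation `h` times q³ is the full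
  -- geometric sum.
  have hgeom : ∀ k l, k ≠ l → 1 + q k l + q k l ^ 2 + q k l ^ 3 + q k l ^ 4 + q k l ^ 5 +
      q k l ^ 6 = 0 := by
    intro k l hkl
    have e := h k l hkl
    have f : ∀ z w : ℂ, z * conj w = conj (conj z * w) := fun z w => by simp
    rw [f (conj (X 0 k) * X 1 k), f (conj (X 1 k) * X 2 k), f (conj (X 2 k) * X 0 k), hbq, hcq] at e
    have e0 : conj (conj (X 0 k) * X 1 k) * (conj (X 0 l) * X 1 l) = q k l := by rw [hq, ha]
    rw [e0] at e
    simp only [map_pow, Complex.conj_conj] at e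
    have w := hqq k l
    linear_combination q k l ^ 3 * e - (q k l ^ 2 + q k l * (conj (q k l) * q k l + 1) +
      ((conj (q k l) * q k l) ^ 2 + conj (q k l) * q k l + 1)) * w
  have hq7 : ∀ k l, q k l ^ 7 = 1 := by
    intro k l
    by_cases hkl : k = l
    · subst hkl
      have : q k k = 1 := by rw [hq]; exact haa k
      rw [this, one_pow]
    · linear_combination (q k l - 1) * hgeom k l hkl
  have hqne : ∀ k l, k ≠ l → q k l ≠ 1 := fun k l hkl h1 => by
    have e := hgeom k l hkl
    rw [h1] at e
    norm_num at e
  have hζ := Complex.isPrimitiveRoot_exp 7 (by norm_num)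
  have hroot : ∀ k, ∃ i : Fin 7, Complex.exp (2 * Real.pi * Complex.I / 7) ^ (i : ℕ) = q 0 k := by
    intro k
    obtain ⟨i, hi, hi'⟩ := hζ.eq_pow_of_pow_eq_one (hq7 0 k)
    exact ⟨⟨i, hi⟩, by simpa using hi'⟩
  choose s hs using hroot
  have hqs : ∀ k l, q k l = conj (q 0 k) * q 0 l := fun k l => by
    simp only [hq, map_mul, Complex.conj_conj]
    linear_combination (-conj (a k) * a l) * haa 0
  have hinj : Function.Injective s := by
    intro k l hkl
    by_contra hne
    apply hqne k l hne
    rw [hqs, ← hs k, ← hs l, hkl, hs l, hqq]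
  refine ⟨Equiv.ofBijective s (Finite.injective_iff_bijective.1 hinj), fun k => conj (X 0 k),
    fun k => by simpa [mul_comm] using hX 0 k, fun k l => ?_⟩
  simp only [harmonicGram, Equiv.ofBijective_apply, hs, Complex.conj_conj]
  rw [← hqs]
  linear_combination hq1 k l + hq2 k l

/-! ### From frames to matrices, and uniqueness -/

open Matrix ComplexConjugate in
theorem inner_eq_conjTranspose_mul (φ : Fin 7 → EuclideanSpace ℂ (Fin 3))
    (F : Matrix (Fin 3) (Fin 7) ℂ) (hF : ∀ a i, F a i = φ i a) (i j : Fin 7) :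
    inner ℂ (φ i) (φ j) = (Fᴴ * F) i j := by
  simp [Matrix.mul_apply, PiLp.inner_apply, hF, mul_comm]

theorem welchBound_seven_three_sq : welchBound 7 3 ^ 2 = 2 / 9 := by
  rw [welchBound, Real.sq_sqrt] <;> norm_num

open Matrix ComplexConjugate in
theorem IsEquiangularFrame.matrix_conditions {φ : Fin 7 → EuclideanSpace ℂ (Fin 3)}
    (h : IsEquiangularFrame φ) (F : Matrix (Fin 3) (Fin 7) ℂ) (hF : ∀ a i, F a i = φ i a) :
    (∀ i, (Fᴴ * F) i i = 1) ∧ (∀ i j, i ≠ j → (Fᴴ * F) i j * (Fᴴ * F) j i = 2 / 9) ∧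
      F * Fᴴ = (7 / 3 : ℂ) • (1 : Matrix (Fin 3) (Fin 3) ℂ) := by
  have hin := inner_eq_conjTranspose_mul φ F hF
  have h1 : ∀ i, (Fᴴ * F) i i = 1 := fun i => by
    rw [← hin, inner_self_eq_norm_sq_to_K, h.norm_eq_one]
    norm_num
  refine ⟨h1, fun i j hij => ?_, ?_⟩
  · rw [← hin, ← hin, ← inner_conj_symm (φ j) (φ i), Complex.mul_conj',
      h.norm_inner_eq i j hij, ← Complex.ofReal_pow, welchBound_seven_three_sq]
    norm_num
  · obtain ⟨A, -, hA⟩ := h.tight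
    -- Frame operator minus A: its quadratic form vanishes by tightness, so over ℂ it is zero. The
    -- trace then gives 3A = 7.
    let T : EuclideanSpace ℂ (Fin 3) →ₗ[ℂ] EuclideanSpace ℂ (Fin 3) :=
      { toFun := fun x => ∑ i, inner ℂ (φ i) x • φ i - (A : ℂ) • x
        map_add' := fun x y => by
          simp only [inner_add_right, add_smul, Finset.sum_add_distrib, smul_add]
          abel
        map_smul' := fun t x => by
          simp only [inner_smul_right, mul_smul, RingHom.id_apply, smul_sub, Finset.smul_sum]
          rw [smul_comm t (A : ℂ) x] }
    have hT : T = 0 := by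
      rw [← inner_map_self_eq_zero]
      intro x
      have e : inner ℂ (T x) x = ((∑ i, ‖inner ℂ (φ i) x‖ ^ 2 - A * ‖x‖ ^ 2 : ℝ) : ℂ) := by
        change inner ℂ (∑ i, inner ℂ (φ i) x • φ i - (A : ℂ) • x) x = _
        simp only [inner_sub_left, sum_inner, inner_smul_left, Complex.conj_mul',
          Complex.conj_ofReal, inner_self_eq_norm_sq_to_K]
        push_cast
        rfl
      rw [e, hA, sub_self, Complex.ofReal_zero]
    have hFF : F * Fᴴ = (A : ℂ) • (1 : Matrix (Fin 3) (Fin 3) ℂ) := by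
      ext a b
      have e := congrArg (fun L : EuclideanSpace ℂ (Fin 3) →ₗ[ℂ] EuclideanSpace ℂ (Fin 3) =>
        L (EuclideanSpace.single b 1) a) hT
      change (∑ i, inner ℂ (φ i) (EuclideanSpace.single b 1) • φ i -
        (A : ℂ) • EuclideanSpace.single b (1 : ℂ)).ofLp a = 0 at e
      simp [EuclideanSpace.inner_single_right, sub_eq_zero] at e
      simp only [Matrix.mul_apply, conjTranspose_apply, hF, Matrix.smul_apply, Matrix.one_apply,
        smul_eq_mul]
      simpa [mul_comm, Pi.single_apply] using e
    have htr := congrArg trace hFF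
    rw [trace_mul_comm, trace_smul, trace_one, trace] at htr
    simp [h1] at htr
    rw [hFF, show (A : ℂ) = 7 / 3 by linear_combination -htr / 3]

-- The diagonal terms of the product contribute 3, so the cross terms sum to −1.
open Matrix ComplexConjugate in
theorem hexagon_of_flat {X : Fin 3 → Fin 7 → ℂ} (hX : ∀ j k, conj (X j k) * X j k = 1)
    {k l : Fin 7}
    (h : (conj (X 0 k) * X 0 l + conj (X 1 k) * X 1 l + conj (X 2 k) * X 2 l) *
      (conj (X 0 l) * X 0 k + conj (X 1 l) * X 1 k + conj (X 2 l) * X 2 k) = 2) :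
    1 + (conj (conj (X 0 k) * X 1 k) * (conj (X 0 l) * X 1 l) +
        (conj (X 0 k) * X 1 k) * conj (conj (X 0 l) * X 1 l)) +
      (conj (conj (X 1 k) * X 2 k) * (conj (X 1 l) * X 2 l) +
        (conj (X 1 k) * X 2 k) * conj (conj (X 1 l) * X 2 l)) +
      (conj (conj (X 2 k) * X 0 k) * (conj (X 2 l) * X 0 l) +
        (conj (X 2 k) * X 0 k) * conj (conj (X 2 l) * X 0 l)) = 0 := by
  simp only [map_mul, Complex.conj_conj]
  linear_combination h - (conj (X 0 l) * X 0 l) * hX 0 k - hX 0 l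
    - (conj (X 1 l) * X 1 l) * hX 1 k - hX 1 l - (conj (X 2 l) * X 2 l) * hX 2 k - hX 2 l

open Matrix ComplexConjugate in
theorem IsEquiangularFrame.exists_harmonicGram {φ : Fin 7 → EuclideanSpace ℂ (Fin 3)}
    (h : IsEquiangularFrame φ) :
    ∃ (σ : Equiv.Perm (Fin 7)) (d : Fin 7 → ℂ), (∀ k, conj (d k) * d k = 1) ∧
      ∀ k l, inner ℂ (φ k) (φ l) = d k * conj (d l) * (harmonicGram (σ k) (σ l) / 3) := by
  obtain ⟨F, hF⟩ : ∃ F : Matrix (Fin 3) (Fin 7) ℂ, ∀ a i, F a i = φ i a :=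
    ⟨of fun a i => φ i a, fun _ _ => rfl⟩
  obtain ⟨h1, h2, h3⟩ := h.matrix_conditions F hF
  obtain ⟨X, hX, hFX⟩ := exists_flat_coordinates h1 h2 h3
  have hG : ∀ k l, inner ℂ (φ k) (φ l) =
      (1 / 3) * (conj (X 0 k) * X 0 l + conj (X 1 k) * X 1 l + conj (X 2 k) * X 2 l) := by
    intro k l
    rw [inner_eq_conjTranspose_mul φ F hF, hFX]
    simp [Matrix.mul_apply, Fin.sum_univ_three]
  have hmod : ∀ k l, k ≠ l →
      (conj (X 0 k) * X 0 l + conj (X 1 k) * X 1 l + conj (X 2 k) * X 2 l) *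
      (conj (X 0 l) * X 0 k + conj (X 1 l) * X 1 k + conj (X 2 l) * X 2 k) = 2 := by
    intro k l hkl
    have e := h2 k l hkl
    rw [← inner_eq_conjTranspose_mul φ F hF, ← inner_eq_conjTranspose_mul φ F hF, hG, hG] at e
    linear_combination 9 * e
  have hhex := fun k l hkl => hexagon_of_flat hX (hmod k l hkl)
  obtain ⟨β, hβ | hβ⟩ := sq_eq_smul_of_hexagon (a := fun k => conj (X 0 k) * X 1 k)
    (b := fun k => conj (X 1 k) * X 2 k) (c := fun k => conj (X 2 k) * X 0 k)
    (fun k => by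
      simp only [map_mul, Complex.conj_conj]
      linear_combination (conj (X 1 k) * X 1 k) * hX 0 k + hX 1 k)
    (fun k => by
      simp only [map_mul, Complex.conj_conj]
      linear_combination (conj (X 2 k) * X 2 k) * hX 1 k + hX 2 k)
    (fun k => by
      linear_combination (conj (X 1 k) * X 1 k * (conj (X 2 k) * X 2 k)) * hX 0 k +
        (conj (X 2 k) * X 2 k) * hX 1 k + hX 2 k)
    hhex
  · obtain ⟨σ, d, hd, hσ⟩ := gram_eq_harmonicGram_of_sq_eq hX hhex hβ
    exact ⟨σ, d, hd, fun k l => by rw [hG, hσ]; ring⟩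
  -- Reversing the rows replaces (a, b) by (b̄, ā), which reduces to the other alternative.
  · have hX' : ∀ j k, conj ((X ∘ Fin.rev) j k) * (X ∘ Fin.rev) j k = 1 := fun j k => hX _ k
    have r0 : Fin.rev (0 : Fin 3) = 2 := by decide
    have r1 : Fin.rev (1 : Fin 3) = 1 := by decide
    have r2 : Fin.rev (2 : Fin 3) = 0 := by decide
    obtain ⟨σ, d, hd, hσ⟩ := gram_eq_harmonicGram_of_sq_eq (X := X ∘ Fin.rev) (β := conj β) hX'
      (fun k l hkl => hexagon_of_flat hX' (by
        simp only [Function.comp, r0, r1, r2]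
        linear_combination hmod k l hkl))
      (fun k => by
        have e := congrArg conj (hβ k)
        simp only [map_mul, map_pow, Complex.conj_conj] at e
        simp only [Function.comp, r0, r1, r2]
        linear_combination e)
    simp only [Function.comp, r0, r1, r2] at hσ
    exact ⟨σ, d, hd, fun k l => by rw [hG]; linear_combination (1 / 3) * hσ k l⟩

open Matrix ComplexConjugate in
theorem IsEquiangularFrame.frameEquivalent {φ ψ : Fin 7 → EuclideanSpace ℂ (Fin 3)}
    (hφ : IsEquiangularFrame φ) (hψ : IsEquiangularFrame ψ) : FrameEquivalent φ ψ := by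
  obtain ⟨σ, d, hd, hσ⟩ := hφ.exists_harmonicGram
  obtain ⟨τ, e, he, hτ⟩ := hψ.exists_harmonicGram
  have hnorm : ∀ z : ℂ, conj z * z = 1 → ‖z‖ = 1 := fun z hz => by
    rw [Complex.conj_mul'] at hz
    exact (pow_eq_one_iff_of_nonneg (norm_nonneg z) two_ne_zero).1 (by exact_mod_cast hz)
  -- Vectors carrying the same harmonic index are matched, and their phases divided.
  refine ⟨τ.trans σ.symm, fun i => e (τ.symm (σ i)) * conj (d i), fun i => ?_, ?_⟩
  · rw [norm_mul, RCLike.norm_conj, hnorm _ (hd _), hnorm _ (he _), one_mul]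
  · ext i j
    rw [Equiv.Perm.permMatrix, ← PEquiv.toMatrix_symm, ← Equiv.toPEquiv_symm]
    simp only [Matrix.mul_assoc]
    rw [PEquiv.toMatrix_toPEquiv_mul]
    simp only [← Matrix.mul_assoc]
    rw [PEquiv.mul_toMatrix_toPEquiv]
    simp only [submatrix_apply, diagonal_conjTranspose, mul_diagonal, diagonal_mul, gram_apply,
      hσ, hτ, id, Equiv.symm_symm, Equiv.trans_apply, Pi.star_apply, star_mul', Complex.star_def,
      Complex.conj_conj, Equiv.apply_symm_apply, Equiv.symm_apply_apply]
    linear_combination (-e i * conj (e j) * (harmonicGram (τ i) (τ j) / 3)) *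
      (conj (d (σ.symm (τ j))) * d (σ.symm (τ j))) * hd (σ.symm (τ i)) +
      (-e i * conj (e j) * (harmonicGram (τ i) (τ j) / 3)) * hd (σ.symm (τ j))

/-! ### Existence -/

open Matrix ComplexConjugate in
theorem exists_isEquiangularFrame_seven_three :
    ∃ φ : Fin 7 → EuclideanSpace ℂ (Fin 3), IsEquiangularFrame φ := by
  obtain ⟨z, hz⟩ : ∃ z : ℂ, IsPrimitiveRoot z 7 := ⟨_, Complex.isPrimitiveRoot_exp 7 (by norm_num)⟩
  have hz7 : z ^ 7 = 1 := hz.pow_eq_one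
  have hzc : conj z = z ^ 6 := by
    have e : conj z * z = 1 := by
      rw [Complex.conj_mul', Complex.norm_eq_one_of_pow_eq_one hz7 (by norm_num)]
      norm_num
    linear_combination z ^ 6 * e - conj z * hz7
  have hgeom : ∀ n : ℕ, ¬ 7 ∣ n → ∑ k : Fin 7, (z ^ n) ^ (k : ℕ) = 0 := by
    intro n hn
    have h1 : z ^ n ≠ 1 := fun h => hn ((hz.pow_eq_one_iff_dvd n).1 h)
    rw [Fin.sum_univ_eq_sum_range (fun k => (z ^ n) ^ k) 7, geom_sum_eq h1, ← pow_mul, mul_comm,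
      pow_mul, hz7]
    simp
  have hs3 : (((Real.sqrt 3)⁻¹ : ℝ) : ℂ) * (((Real.sqrt 3)⁻¹ : ℝ) : ℂ) = 1 / 3 := by
    rw [← Complex.ofReal_mul, ← mul_inv, Real.mul_self_sqrt (by norm_num)]
    norm_num
  obtain ⟨ε, hε⟩ : ∃ ε : Fin 3 → ℕ, ε = ![0, 1, 3] := ⟨_, rfl⟩
  -- The factor 6 stands for −1 modulo 7, as z̄ = z⁶.
  have hdvd : ∀ a b, a ≠ b → ¬ 7 ∣ ε a + 6 * ε b := by
    subst hε
    decide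
  obtain ⟨F, hF⟩ : ∃ F : Matrix (Fin 3) (Fin 7) ℂ,
    F = of fun a (i : Fin 7) => (((Real.sqrt 3)⁻¹ : ℝ) : ℂ) * (z ^ ε a) ^ (i : ℕ) := ⟨_, rfl⟩
  obtain ⟨φ, hφ⟩ : ∃ φ : Fin 7 → EuclideanSpace ℂ (Fin 3), ∀ a i, F a i = φ i a :=
    ⟨fun i => WithLp.toLp 2 fun a => F a i, fun _ _ => rfl⟩
  have hin := inner_eq_conjTranspose_mul φ F hφ
  have hG : ∀ i j : Fin 7, (Fᴴ * F) i j = (1 / 3) * (1 + z ^ (6 * (i : ℕ) + j) +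
      (z ^ (6 * (i : ℕ) + j)) ^ 3) := by
    intro i j
    simp only [Matrix.mul_apply, conjTranspose_apply, Fin.sum_univ_three, hF, of_apply, hε,
      star_mul', star_pow, Complex.star_def, Complex.conj_ofReal, hzc]
    simp only [← hs3, cons_val]
    ring
  have hFF : F * Fᴴ = (7 / 3 : ℂ) • (1 : Matrix (Fin 3) (Fin 3) ℂ) := by
    ext a b
    have e : (F * Fᴴ) a b = (1 / 3) * ∑ k : Fin 7, (z ^ (ε a + 6 * ε b)) ^ (k : ℕ) := by
      simp only [Matrix.mul_apply, conjTranspose_apply, hF, of_apply, star_mul', star_pow,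
        Complex.star_def, Complex.conj_ofReal, hzc, Finset.mul_sum, ← hs3]
      exact Finset.sum_congr rfl fun k _ => by ring
    rw [e]
    by_cases hab : a = b
    · subst hab
      have h1 : z ^ (ε a + 6 * ε a) = 1 := (hz.pow_eq_one_iff_dvd _).2 ⟨ε a, by ring⟩
      simp [h1]
      norm_num
    · rw [hgeom]
      · simp [hab]
      · exact hdvd a b hab
  refine ⟨φ, fun i => ?_, ⟨7 / 3, by norm_num, fun x => ?_⟩, fun i j hij => ?_⟩
  · have e := hin i i
    rw [hG, (hz.pow_eq_one_iff_dvd _).2 ⟨(i : ℕ), by ring⟩, inner_self_eq_norm_sq_to_K] at e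
    have e' : ((‖φ i‖ ^ 2 : ℝ) : ℂ) = ((1 : ℝ) : ℂ) := by
      push_cast
      exact e.trans (by norm_num)
    exact (pow_eq_one_iff_of_nonneg (norm_nonneg _) two_ne_zero).1 (Complex.ofReal_injective e')
  · have hx : ∀ i, inner ℂ (φ i) x = (Fᴴ *ᵥ x) i := fun i => by
      simp [Matrix.mulVec, dotProduct, PiLp.inner_apply, hφ, mul_comm]
    have e : star (Fᴴ *ᵥ x) ⬝ᵥ (Fᴴ *ᵥ x) = (7 / 3) * (star x.ofLp ⬝ᵥ x.ofLp) := by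
      rw [star_mulVec, conjTranspose_conjTranspose, ← dotProduct_mulVec, mulVec_mulVec, hFF,
        smul_mulVec, one_mulVec, dotProduct_smul, smul_eq_mul]
    rw [EuclideanSpace.norm_sq_eq]
    simp only [hx]
    simp only [dotProduct, Pi.star_apply, Complex.star_def, Complex.conj_mul'] at e
    apply Complex.ofReal_injective
    push_cast
    exact e
  · have hne : z ^ (6 * (i : ℕ) + j) ≠ 1 := fun h => by
      have := (hz.pow_eq_one_iff_dvd _).1 h
      exact hij (Fin.ext (by omega))
    obtain ⟨q, hq⟩ : ∃ q, q = z ^ (6 * (i : ℕ) + j) := ⟨_, rfl⟩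
    have hq7 : q ^ 7 = 1 := by rw [hq, ← pow_mul, mul_comm, pow_mul, hz7, one_pow]
    have hqc : conj q = q ^ 6 := by rw [hq, map_pow, hzc, ← pow_mul, ← pow_mul, mul_comm]
    have hqs : 1 + q + q ^ 2 + q ^ 3 + q ^ 4 + q ^ 5 + q ^ 6 = 0 := by
      have e : (q - 1) * (1 + q + q ^ 2 + q ^ 3 + q ^ 4 + q ^ 5 + q ^ 6) = 0 := by
        linear_combination hq7
      exact (mul_eq_zero.1 e).resolve_left (sub_ne_zero.2 (hq ▸ hne))
    -- Differences of 0, 1, 3 hit each nonzero residue once: |1 + q + q³|² = 3 + (q + … + q⁶) = 2.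
    have e : ‖inner ℂ (φ i) (φ j)‖ ^ 2 = welchBound 7 3 ^ 2 := by
      rw [welchBound_seven_three_sq]
      apply Complex.ofReal_injective
      push_cast
      rw [← Complex.conj_mul', hin, hG, ← hq]
      simp only [map_mul, map_add, map_pow, map_one, map_div₀, map_ofNat, hqc]
      linear_combination (1 / 9) * hqs + (1 / 9) * (1 + q ^ 2 + (q ^ 4 + q ^ 5) * (1 + q ^ 7) +
        (1 + q ^ 7 + q ^ 14)) * hq7
    exact (sq_eq_sq₀ (norm_nonneg _) (Real.sqrt_nonneg _)).1 e

theorem mainTheorem5 :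
    (∃ φ : Fin 7 → EuclideanSpace ℂ (Fin 3), IsEquiangularFrame φ) ∧
      ∀ φ ψ : Fin 7 → EuclideanSpace ℂ (Fin 3),
        IsEquiangularFrame φ → IsEquiangularFrame ψ → FrameEquivalent φ ψ :=
  ⟨exists_isEquiangularFrame_seven_three, fun _ _ hφ hψ => hφ.frameEquivalent hψ⟩
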